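/- Let $R$ be a nonzero commutative ring with identity, and let $\mathcal{G}$ be a Hausdorff ample groupoid: a Hausdorff topological groupoid whose unit space $\mathcal{G}^{(0)}$ is locally compact Hausdorff, whose source map $s:\mathcal{G}\to\mathcal{G}^{(0)}$ is a local homeomorphism, and which has a basis of compact open bisections (a bisection is a set $B\subseteq\mathcal{G}$ on which the range map $r$ and the source map $s$ are injective). Let $\mathcal{G}^a$ be the inverse semigroup of compact open bisections of $\mathcal{G}$, with $BC=\{bc \mid b\in B,\ c\in C,\ s(b)=r(c)\}$ and $B^{*}=\{b^{-1}\mid b\in B\}$, let $\leq$ be its natural partial order (which is inclusion), and let $E(\mathcal{G}^a)$ be its set of idempotents (the compact open subsets of $\mathcal{G}^{(0)}$). Let $\mathcal{L}_c(\mathcal{G}^{(0)})$ be the ring of locally constant, compactly supported functions $\mathcal{G}^{(0)}\to R$ with pointwise operations. For $B\in\mathcal{G}^a$ let $D_B=\{f\in\mathcal{L}_c(\mathcal{G}^{(0)}) \mid \operatorname{supp} f\subseteq r(B)\}$, and let $\alpha_B:D_{B^*}\to D_B$ be the ring isomorphism with $\alpha_B(f)(r(b))=f(s(b))$ for $b\in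 B$ and $\alpha_B(f)=0$ off $r(B)$. Let $\mathcal{L}$ be the ring of finite formal sums $\sum_B f_B\delta_B$ with $f_B\in D_B$, added componentwise and multiplied by the biadditive extension of $(f\delta_B)(g\delta_C)=\alpha_B(\alpha_{B^*}(f)\,g)\,\delta_{BC}$. Let $\mathcal{N}$ be the two-sided ideal of $\mathcal{L}$ generated by all $f\delta_B-f\delta_C$ with $B\leq C$ and $f\in D_B$. Put $\mathcal{L}_c(\mathcal{G}^{(0)})\rtimes\mathcal{G}^a=\mathcal{L}/\mathcal{N}$, write $\overline{x}$ for the class of $x$, and let $$\mathcal{D}=\Big\{\sum_{i=1}^n\overline{f_i\delta_{U_i}}\ \Big|\ n\in\mathbb{N},\ U_i\in E(\mathcal{G}^a),\ f_i\in D_{U_i}\Big\}.$$ Then there is an injective ring homomorphism $\varphi:\mathcal{L}_c(\mathcal{G}^{(0)})\to\mathcal{L}_c(\mathcal{G}^{(0)})\rtimes\mathcal{G}^a$ with image $\mathcal{D}$ and with $\varphi(f)=\overline{f\delta_U}$ for all $U\in E(\mathcal{G}^a)$ and $f\in D_U$; in particular $\mathcal{D}$ is a subring isomorphic to $\mathcal{L}_c(\mathcal{G}^{(0)})$.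 Moreover, $\mathcal{G}$ is effective, that is, the interior of $\{b\in\mathcal{G}\mid r(b)=s(b)\}$ is $\mathcal{G}^{(0)}$, if and only if $\mathcal{D}$ is maximal commutative in $\mathcal{L}_c(\mathcal{G}^{(0)})\rtimes\mathcal{G}^a$, that is, $\mathcal{D}$ equals its own centralizer. -/

import Mathlib

open Topology Set

/-! ## Inverse semigroups, partial actions on rings, skew inverse semigroup rings -/

/-- An inverse semigroup: a semigroup in which every `s` has exactly one `s⁻¹` with
`s s⁻¹ s = s` and `s⁻¹ s s⁻¹ = s⁻¹`. -/
class InverseSemigroup (S : Type*) extends Semigroup S, Inv S where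
  mul_inv_mul_self : ∀ s : S, s * s⁻¹ * s = s
  inv_mul_inv_self : ∀ s : S, s⁻¹ * s * s⁻¹ = s⁻¹
  eq_inv_of : ∀ s t : S, s * t * s = s → t * s * t = t → t = s⁻¹

namespace InverseSemigroup

/-- The natural partial order of an inverse semigroup. -/
def NatLE {S : Type*} [InverseSemigroup S] (s t : S) : Prop := s = t * s⁻¹ * s

end InverseSemigroup

/-- A partial action of an inverse semigroup `S` on a ring `A`: two-sided ideals `D s` and ring
isomorphisms `π s : D s⁻¹ → D s`. The map `π s` is recorded as a map `A → A`, whose values outside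
`D s⁻¹` play no role. -/
structure PartialAction (S : Type*) [InverseSemigroup S] (A : Type*) [NonUnitalRing A] where
  D : S → TwoSidedIdeal A
  π : S → A → A
  bijOn : ∀ s, BijOn (π s) (D s⁻¹ : Set A) (D s : Set A)
  π_add : ∀ s, ∀ a ∈ D s⁻¹, ∀ b ∈ D s⁻¹, π s (a + b) = π s a + π s b
  π_mul : ∀ s, ∀ a ∈ D s⁻¹, ∀ b ∈ D s⁻¹, π s (a * b) = π s a * π s b
  generates : AddSubgroup.closure (⋃ e ∈ {e : S | IsIdempotentElem e}, (D e : Set A)) = ⊤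
  image_inter : ∀ s t, π s '' ((D s⁻¹ : Set A) ∩ D t) = (D s : Set A) ∩ D (s * t)
  π_comp : ∀ s t, ∀ x ∈ D t⁻¹, x ∈ D (t⁻¹ * s⁻¹) → π s (π t x) = π (s * t) x

namespace PartialAction

variable {S : Type*} [InverseSemigroup S] {A : Type*} [NonUnitalRing A] (P : PartialAction S A)

theorem inv_inv' (s : S) : (s⁻¹)⁻¹ = s :=
  (InverseSemigroup.eq_inv_of s⁻¹ s (InverseSemigroup.inv_mul_inv_self s)
    (InverseSemigroup.mul_inv_mul_self s)).symm

theorem π_inv_mem {s : S} {a : A} (ha : a ∈ P.D s) : P.π s⁻¹ a ∈ P.D s⁻¹ :=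
  (P.bijOn s⁻¹).mapsTo (by rw [inv_inv']; exact ha)

theorem coeff_mem {s t : S} {a b : A} (ha : a ∈ P.D s) (hb : b ∈ P.D t) :
    P.π s (P.π s⁻¹ a * b) ∈ P.D (s * t) := by
  have h : P.π s (P.π s⁻¹ a * b) ∈ P.π s '' ((P.D s⁻¹ : Set A) ∩ P.D t) :=
    ⟨_, ⟨TwoSidedIdeal.mul_mem_right _ _ _ (P.π_inv_mem ha),
      TwoSidedIdeal.mul_mem_left _ _ _ hb⟩, rfl⟩
  rw [P.image_inter] at h
  exact h.2

/-- The biadditive map `(a, b) ↦ π_s(π_{s⁻¹}(a) b)` from `D s × D t` to `D (s * t)`. -/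
def coeffMul (s t : S) : P.D s →+ P.D t →+ P.D (s * t) :=
  AddMonoidHom.mk' (fun a => AddMonoidHom.mk'
    (fun b => ⟨P.π s (P.π s⁻¹ a * b), P.coeff_mem a.2 b.2⟩)
    (by
      intro b c
      apply Subtype.ext
      have h := P.π_inv_mem a.2
      change P.π s (P.π s⁻¹ a * (b + c)) = P.π s (P.π s⁻¹ a * b) + P.π s (P.π s⁻¹ a * c)
      rw [mul_add, P.π_add _ _ (TwoSidedIdeal.mul_mem_right _ _ _ h) _
        (TwoSidedIdeal.mul_mem_right _ _ _ h)]))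
    (by
      intro a a'
      ext b
      have h := P.π_inv_mem a.2
      have h' := P.π_inv_mem a'.2
      change P.π s (P.π s⁻¹ (a + a') * b) = P.π s (P.π s⁻¹ a * b) + P.π s (P.π s⁻¹ a' * b)
      rw [P.π_add s⁻¹ _ (by rw [inv_inv']; exact a.2) _ (by rw [inv_inv']; exact a'.2), add_mul,
        P.π_add _ _ (TwoSidedIdeal.mul_mem_right _ _ _ h) _
        (TwoSidedIdeal.mul_mem_right _ _ _ h')])

open scoped Classical in
/-- The biadditive extension of `(a δ_s, b δ_t) ↦ π_s(π_{s⁻¹}(a) b) δ_{st}` to finite formal sums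
`∑ a_s δ_s`, `a_s ∈ D s`. -/
noncomputable def mulHom : (DirectSum S fun s => P.D s) →+ (DirectSum S fun s => P.D s) →+
    (DirectSum S fun s => P.D s) :=
  DirectSum.toAddMonoid fun s => AddMonoidHom.flip <|
    DirectSum.toAddMonoid fun t => AddMonoidHom.flip <|
      (DirectSum.of (fun s => P.D s) (s * t)).compHom.comp (P.coeffMul s t)

open scoped Classical in
theorem mulHom_of_of (s t : S) (a : P.D s) (b : P.D t) :
    P.mulHom (DirectSum.of (fun s => P.D s) s a) (DirectSum.of (fun s => P.D s) t b) =
      DirectSum.of (fun s => P.D s) (s * t) (P.coeffMul s t a b) := by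
  simp [mulHom]

/-- The ring `𝓛` of finite formal sums `∑ a_s δ_s` with `a_s ∈ D s`, with componentwise addition
and the multiplication `mulHom`. -/
def FormalSum : Type _ := DirectSum S (fun s => P.D s)

noncomputable instance : AddCommGroup P.FormalSum :=
  inferInstanceAs (AddCommGroup (DirectSum S (fun s => P.D s)))

noncomputable instance : NonUnitalNonAssocRing P.FormalSum :=
  { (inferInstance : AddCommGroup P.FormalSum) with
    mul := fun x y => P.mulHom x y
    left_distrib := fun x y z => (P.mulHom x).map_add y z
    right_distrib := fun x y z => DFunLike.congr_fun (P.mulHom.map_add x y) z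
    zero_mul := fun x => DFunLike.congr_fun P.mulHom.map_zero x
    mul_zero := fun x => (P.mulHom x).map_zero }

open scoped Classical in
/-- The homogeneous element `a δ_s`. -/
noncomputable def delta (s : S) : P.D s →+ P.FormalSum := DirectSum.of (fun s => P.D s) s

theorem delta_mul_delta (s t : S) (a : P.D s) (b : P.D t) :
    P.delta s a * P.delta t b =
      P.delta (s * t) ⟨P.π s (P.π s⁻¹ a * b), P.coeff_mem a.2 b.2⟩ :=
  P.mulHom_of_of s t a b

/-- The ideal `𝓝` of `𝓛` generated by the elements `a δ_r - a δ_t` with `r ≤ t` and `a ∈ D r`.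
(Membership of `a` in `D t` is automatic for `r ≤ t`; it is recorded so that `a δ_t` typechecks.) -/
noncomputable def relIdeal : TwoSidedIdeal P.FormalSum :=
  TwoSidedIdeal.span {x | ∃ (r t : S) (a : A) (hr : a ∈ P.D r) (ht : a ∈ P.D t),
    InverseSemigroup.NatLE r t ∧ x = P.delta r ⟨a, hr⟩ - P.delta t ⟨a, ht⟩}

/-- The skew inverse semigroup ring `A ⋊ S = 𝓛 / 𝓝`. -/
abbrev SkewRing : Type _ := P.relIdeal.ringCon.Quotient

/-- The class of `a δ_s` in `A ⋊ S`. -/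
noncomputable def deltaBar (s : S) (a : P.D s) : P.SkewRing :=
  ((P.delta s a : P.FormalSum) : P.relIdeal.ringCon.Quotient)

/-- The diagonal `𝓓` of `A ⋊ S`: the set of finite sums of classes of `a δ_e`, with `e` idempotent
and `a ∈ D e`. -/
def diagonal : Set P.SkewRing :=
  {x | ∃ (n : ℕ) (e : Fin n → S) (a : ∀ i, P.D (e i)), (∀ i, IsIdempotentElem (e i)) ∧
    x = ∑ i, P.deltaBar (e i) (a i)}

end PartialAction

/-- A subset of a ring is maximal commutative if it equals its own centralizer. -/
def IsMaximalCommutative {A : Type*} [Mul A] (M : Set A) : Prop := M.centralizer = M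

/-! ## Ample groupoids -/

/-- A groupoid given by its set `G` of arrows; units are identified with arrows. The product `a * b`
is the composite when `src a = rng b`, and plays no role otherwise. -/
class ArrowGroupoid (G : Type*) extends Mul G, Inv G where
  src : G → G
  rng : G → G
  src_src : ∀ a, src (src a) = src a
  rng_src : ∀ a, rng (src a) = src a
  src_rng : ∀ a, src (rng a) = rng a
  rng_rng : ∀ a, rng (rng a) = rng a
  src_mul : ∀ a b, src a = rng b → src (a * b) = src b
  rng_mul : ∀ a b, src a = rng b → rng (a * b) = rng a
  assoc : ∀ a b c, src a = rng b → src b = rng c → a * b * c = a * (b * c)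
  mul_src : ∀ a, a * src a = a
  rng_mul_self : ∀ a, rng a * a = a
  src_inv : ∀ a, src a⁻¹ = rng a
  rng_inv : ∀ a, rng a⁻¹ = src a
  mul_inv_self : ∀ a, a * a⁻¹ = rng a
  inv_mul_self : ∀ a, a⁻¹ * a = src a

namespace ArrowGroupoid

section Algebra

variable (G : Type*) [ArrowGroupoid G]

/-- The unit space `G⁽⁰⁾`, a subset of `G`. -/
def units : Set G := {u | src u = u}

/-- The isotropy subgroupoid. -/
def iso : Set G := {b | rng b = src b}

variable {G}

/-- The source map `G → G⁽⁰⁾`. -/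
def srcMap (a : G) : units G := ⟨src a, src_src a⟩

/-- The range map `G → G⁽⁰⁾`. -/
def rngMap (a : G) : units G := ⟨rng a, src_rng a⟩

/-- A bisection: a set of arrows on which range and source are both injective. -/
def IsBisection (B : Set G) : Prop := InjOn (rng : G → G) B ∧ InjOn (src : G → G) B

/-- The product `BC` of two sets of arrows. -/
def setMul (B C : Set G) : Set G := {a | ∃ b ∈ B, ∃ c ∈ C, src b = rng c ∧ a = b * c}

/-- The set of inverses of a set of arrows. -/
def setInv (B : Set G) : Set G := {a | ∃ b ∈ B, a = b⁻¹}

theorem inv_mul_cancel_left' (a b : G) (h : src a = rng b) : a⁻¹ * (a * b) = b := by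
  rw [← assoc _ _ _ (src_inv a) h, inv_mul_self, h, rng_mul_self]

theorem mul_inv_cancel_left' (a b : G) (h : rng a = rng b) : a * (a⁻¹ * b) = b := by
  rw [← assoc _ _ _ (rng_inv a).symm (by rw [src_inv, h]), mul_inv_self, h, rng_mul_self]

theorem inv_inv' (a : G) : a⁻¹⁻¹ = a := by
  have h := inv_mul_cancel_left' a⁻¹ a (src_inv a)
  rwa [inv_mul_self, ← rng_inv a, ← src_inv a⁻¹, mul_src] at h

theorem mem_setInv {B : Set G} {a : G} : a ∈ setInv B ↔ a⁻¹ ∈ B := by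
  constructor
  · rintro ⟨b, hb, rfl⟩
    rwa [inv_inv']
  · intro h
    exact ⟨_, h, (inv_inv' a).symm⟩

theorem isBisection_setMul {B C : Set G} (hB : IsBisection B) (hC : IsBisection C) :
    IsBisection (setMul B C) := by
  constructor
  · rintro _ ⟨b, hb, c, hc, h, rfl⟩ _ ⟨b', hb', c', hc', h', rfl⟩ e
    rw [rng_mul _ _ h, rng_mul _ _ h'] at e
    obtain rfl := hB.1 hb hb' e
    obtain rfl := hC.1 hc hc' (h.symm.trans h')
    rfl
  · rintro _ ⟨b, hb, c, hc, h, rfl⟩ _ ⟨b', hb', c', hc', h', rfl⟩ e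
    rw [src_mul _ _ h, src_mul _ _ h'] at e
    obtain rfl := hC.2 hc hc' e
    obtain rfl := hB.2 hb hb' (h.trans h'.symm)
    rfl

theorem isBisection_setInv {B : Set G} (hB : IsBisection B) : IsBisection (setInv B) := by
  constructor
  · rintro _ ⟨b, hb, rfl⟩ _ ⟨b', hb', rfl⟩ e
    rw [rng_inv, rng_inv] at e
    rw [hB.2 hb hb' e]
  · rintro _ ⟨b, hb, rfl⟩ _ ⟨b', hb', rfl⟩ e
    rw [src_inv, src_inv] at e
    rw [hB.1 hb hb' e]

theorem setMul_assoc (B C D : Set G) : setMul (setMul B C) D = setMul B (setMul C D) := by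
  ext x
  constructor
  · rintro ⟨_, ⟨b, hb, c, hc, h, rfl⟩, d, hd, h', rfl⟩
    rw [src_mul _ _ h] at h'
    exact ⟨b, hb, c * d, ⟨c, hc, d, hd, h', rfl⟩, by rw [rng_mul _ _ h', h], assoc _ _ _ h h'⟩
  · rintro ⟨b, hb, _, ⟨c, hc, d, hd, h', rfl⟩, h, rfl⟩
    rw [rng_mul _ _ h'] at h
    exact ⟨b * c, ⟨b, hb, c, hc, h, rfl⟩, d, hd, by rw [src_mul _ _ h, h'], (assoc _ _ _ h h').symm⟩

theorem setMul_setInv_setMul {B : Set G} (hB : IsBisection B) :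
    setMul (setMul B (setInv B)) B = B := by
  ext x
  constructor
  · rintro ⟨_, ⟨b, hb, _, ⟨c, hc, rfl⟩, h, rfl⟩, d, hd, h', rfl⟩
    rw [src_mul _ _ h, src_inv] at h'
    obtain rfl := hB.1 hc hd h'
    rw [rng_inv] at h
    rw [assoc _ _ _ (by rw [rng_inv, h]) (by rw [src_inv]), inv_mul_self, ← h, mul_src]
    exact hb
  · intro hx
    exact ⟨rng x, ⟨x, hx, x⁻¹, ⟨x, hx, rfl⟩, (rng_inv x).symm, (mul_inv_self x).symm⟩, x, hx,
      src_rng x, (rng_mul_self x).symm⟩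

theorem setInv_setInv (B : Set G) : setInv (setInv B) = B := by
  ext x
  rw [mem_setInv, mem_setInv, inv_inv']

theorem setInv_subset_of {B C : Set G} (hC : IsBisection C)
    (h : setMul (setMul C B) C = C) : setInv C ⊆ B := by
  rintro _ ⟨c, hc, rfl⟩
  have hc' := hc
  rw [← h] at hc'
  obtain ⟨_, ⟨d, hd, b, hb, h1, rfl⟩, e, he, h2, h3⟩ := hc'
  have hs : src (d * b) = rng e := h2
  rw [src_mul _ _ h1] at h2
  have e1 : rng c = rng d := by rw [h3, rng_mul _ _ hs, rng_mul _ _ h1]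
  have e2 : src c = src e := by rw [h3, src_mul _ _ hs]
  obtain rfl := hC.1 hc hd e1
  obtain rfl := hC.2 hc he e2
  have hb' : c⁻¹ = b := by
    have h4 : c⁻¹ * c = b * c := by
      have h6 := inv_mul_cancel_left' c (b * c) (by rw [rng_mul _ _ h2, h1])
      rwa [← assoc _ _ _ h1 h2, ← h3] at h6
    have h5 : b * c * c⁻¹ = b := by
      rw [assoc _ _ _ h2 (rng_inv c).symm, mul_inv_self, ← h2, mul_src]
    rw [← h5, ← h4, inv_mul_self, ← rng_inv, rng_mul_self]
  rw [hb']
  exact hb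

end Algebra

/-! ### Topology -/

section Topology

variable (G : Type*) [TopologicalSpace G] [ArrowGroupoid G]

/-- A topological groupoid: composition and inversion are continuous. -/
class IsTopological : Prop where
  continuous_inv : Continuous fun a : G => a⁻¹
  continuousOn_mul : ContinuousOn (fun p : G × G => p.1 * p.2) {p | src p.1 = rng p.2}

/-- An étale groupoid. -/
class IsEtale : Prop extends IsTopological G where
  locallyCompactSpace_units : LocallyCompactSpace (units G)
  t2Space_units : T2Space (units G)
  isLocalHomeomorph_srcMap : IsLocalHomeomorph (srcMap : G → units G)

/-- An ample groupoid: étale, with a basis of (open) compact bisections. -/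
class IsAmple : Prop extends IsEtale G where
  isTopologicalBasis :
    TopologicalSpace.IsTopologicalBasis {B : Set G | IsOpen B ∧ IsCompact B ∧ IsBisection B}

/-- Effectiveness: the interior of the isotropy is the unit space. -/
def IsEffective : Prop := interior (iso G) = units G

/-- The set `Gᵃ` of compact open bisections of `G`. -/
def CompactBisection : Type _ := {B : Set G // IsOpen B ∧ IsCompact B ∧ IsBisection B}

variable {G}

section

variable [IsEtale G]

theorem continuous_src : Continuous (src : G → G) :=
  continuous_subtype_val.comp (IsEtale.isLocalHomeomorph_srcMap (G := G)).continuous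

theorem continuous_rng : Continuous (rng : G → G) := by
  have h : (rng : G → G) = fun a => src a⁻¹ := by
    funext a
    rw [src_inv]
  rw [h]
  exact continuous_src.comp IsTopological.continuous_inv

/-- Inversion as a homeomorphism. -/
def invHomeomorph : G ≃ₜ G where
  toFun a := a⁻¹
  invFun a := a⁻¹
  left_inv := inv_inv'
  right_inv := inv_inv'
  continuous_toFun := IsTopological.continuous_inv
  continuous_invFun := IsTopological.continuous_inv

theorem isLocalHomeomorph_rngMap : IsLocalHomeomorph (rngMap : G → units G) := by
  have h : (rngMap : G → units G) = srcMap ∘ invHomeomorph := by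
    funext a
    exact Subtype.ext (src_inv a).symm
  rw [h]
  exact (IsEtale.isLocalHomeomorph_srcMap (G := G)).comp invHomeomorph.isLocalHomeomorph

theorem isOpenEmbedding_rngMap {B : Set G} (ho : IsOpen B) (hB : InjOn (rng : G → G) B) :
    IsOpenEmbedding (fun b : B => rngMap (b : G)) := by
  refine (isLocalHomeomorph_rngMap.comp ho.isOpenEmbedding_subtypeVal.isLocalHomeomorph)
    |>.isOpenEmbedding_of_injective ?_
  intro b c h
  exact Subtype.ext (hB b.2 c.2 (congrArg Subtype.val h))

theorem isOpen_units : IsOpen (units G) := by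
  rw [isOpen_iff_mem_nhds]
  intro u hu
  obtain ⟨V, hV, huV, hinj⟩ :=
    (IsEtale.isLocalHomeomorph_srcMap (G := G)).isLocallyInjective u
  have h1 : V ∈ 𝓝 u := hV.mem_nhds huV
  have h2 : src ⁻¹' V ∈ 𝓝 u := by
    refine continuous_src.continuousAt.preimage_mem_nhds ?_
    rw [show src u = u from hu]
    exact h1
  filter_upwards [h1, h2] with w hw hw'
  exact hinj hw' hw (Subtype.ext (src_src w))

theorem isOpen_setMul {B C : Set G} (hBo : IsOpen B) (hB : IsBisection B) (hCo : IsOpen C) :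
    IsOpen (setMul B C) := by
  rw [isOpen_iff_mem_nhds]
  rintro _ ⟨b, hb, c, hc, h, rfl⟩
  have hE := isOpenEmbedding_rngMap hBo hB.1
  set e : B → units G := fun b => rngMap (b : G) with he
  have hrng : e ⟨b, hb⟩ = rngMap (b * c) := Subtype.ext (rng_mul _ _ h).symm
  have hopen : IsOpen ((rngMap : G → units G) ⁻¹' range e) :=
    hE.isOpen_range.preimage isLocalHomeomorph_rngMap.continuous
  have hev : ∀ᶠ x in 𝓝 (b * c), x ∈ setMul B C := by
    have : Nonempty B := ⟨⟨b, hb⟩⟩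
    let g : G → B := fun x => Function.invFun e (rngMap x)
    have hg : ∀ x ∈ (rngMap : G → units G) ⁻¹' range e, e (g x) = rngMap x := by
      intro x hx
      exact Function.invFun_eq hx
    have hgb : g (b * c) = ⟨b, hb⟩ := by
      change Function.invFun e (rngMap (b * c)) = _
      rw [← hrng]
      exact Function.leftInverse_invFun hE.injective _
    have hmem : (b * c) ∈ (rngMap : G → units G) ⁻¹' range e := ⟨_, hrng⟩
    have hgc : ContinuousOn g ((rngMap : G → units G) ⁻¹' range e) := by
      rw [hE.isInducing.continuousOn_iff]
      exact isLocalHomeomorph_rngMap.continuous.continuousOn.congr hg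
    have hcont : ContinuousOn (fun x => ((g x : G))⁻¹ * x)
        ((rngMap : G → units G) ⁻¹' range e) := by
      refine IsTopological.continuousOn_mul.comp (f := fun x => (((g x : G))⁻¹, x)) ?_ ?_
      · exact ((IsTopological.continuous_inv.comp continuous_subtype_val).comp_continuousOn
          hgc).prodMk continuousOn_id
      · intro x hx
        change src ((g x : G))⁻¹ = rng x
        rw [src_inv]
        exact congrArg Subtype.val (hg x hx)
    have hval : ((g (b * c) : G))⁻¹ * (b * c) ∈ C := by
      rw [hgb]
      rwa [inv_mul_cancel_left' b c h]
    filter_upwards [hopen.mem_nhds hmem,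
      (hcont.continuousAt (hopen.mem_nhds hmem)).preimage_mem_nhds (hCo.mem_nhds hval)]
      with x hx hx'
    have hr : rng (g x : G) = rng x := congrArg Subtype.val (hg x hx)
    refine ⟨g x, (g x).2, _, hx', ?_, (mul_inv_cancel_left' _ _ hr).symm⟩
    rw [rng_mul _ _ (by rw [src_inv, hr]), rng_inv]
  exact hev

theorem isCompact_setMul [T2Space G] {B C : Set G} (hB : IsCompact B) (hC : IsCompact C) :
    IsCompact (setMul B C) := by
  have hcl : IsClosed {p : G × G | src p.1 = rng p.2} :=
    isClosed_eq (continuous_src.comp continuous_fst) (continuous_rng.comp continuous_snd)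
  have hK := (hB.prod hC).inter_right hcl
  have h := hK.image_of_continuousOn (IsTopological.continuousOn_mul.mono inter_subset_right)
  convert h using 1
  ext a
  constructor
  · rintro ⟨b, hb, c, hc, h, rfl⟩
    exact ⟨(b, c), ⟨⟨hb, hc⟩, h⟩, rfl⟩
  · rintro ⟨⟨b, c⟩, ⟨⟨hb, hc⟩, h⟩, rfl⟩
    exact ⟨b, hb, c, hc, h, rfl⟩

theorem setInv_eq_preimage (B : Set G) : setInv B = (invHomeomorph : G ≃ₜ G) ⁻¹' B := by
  ext a
  exact mem_setInv

end

namespace CompactBisection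

variable [T2Space G] [IsAmple G]

/-- The inverse semigroup `Gᵃ` of compact open bisections. -/
instance : InverseSemigroup (CompactBisection G) where
  mul B C := ⟨setMul B.1 C.1, isOpen_setMul B.2.1 B.2.2.2 C.2.1, isCompact_setMul B.2.2.1 C.2.2.1,
    isBisection_setMul B.2.2.2 C.2.2.2⟩
  inv B := ⟨setInv B.1, by
      rw [setInv_eq_preimage]
      exact B.2.1.preimage invHomeomorph.continuous, by
      rw [setInv_eq_preimage]
      exact invHomeomorph.isCompact_preimage.2 B.2.2.1, isBisection_setInv B.2.2.2⟩
  mul_assoc B C D := Subtype.ext (setMul_assoc _ _ _)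
  mul_inv_mul_self B := Subtype.ext (setMul_setInv_setMul B.2.2.2)
  inv_mul_inv_self B := Subtype.ext (by
    have h := setMul_setInv_setMul (isBisection_setInv B.2.2.2)
    rwa [setInv_setInv] at h)
  eq_inv_of B C h1 h2 := Subtype.ext (by
    have h1' : setMul (setMul B.1 C.1) B.1 = B.1 := congrArg Subtype.val h1
    have h2' : setMul (setMul C.1 B.1) C.1 = C.1 := congrArg Subtype.val h2
    refine Subset.antisymm ?_ (setInv_subset_of B.2.2.2 h1')
    intro c hc
    exact mem_setInv.2 (setInv_subset_of C.2.2.2 h2' ⟨c, hc, rfl⟩))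

theorem coe_mul (B C : CompactBisection G) : (B * C).1 = setMul B.1 C.1 := rfl

theorem coe_inv (B : CompactBisection G) : (B⁻¹).1 = setInv B.1 := rfl

end CompactBisection

end Topology

end ArrowGroupoid

/-! ## Locally constant functions with compact support -/

/-- The `R`-algebra `𝓛_c(X)` of locally constant, compactly supported functions `X → R`. -/
def LcFun (X R : Type*) [TopologicalSpace X] [CommRing R] :
    NonUnitalSubalgebra R (LocallyConstant X R) where
  carrier := {f | IsCompact (Function.support f)}
  zero_mem' := by
    change IsCompact (Function.support ((0 : LocallyConstant X R) : X → R))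
    simp
  add_mem' := by
    intro f g hf hg
    refine (hf.union hg).of_isClosed_subset ?_ (Function.support_add f g)
    exact ((f + g).isLocallyConstant.isClopen_fiber 0).compl.isClosed
  mul_mem' := by
    intro f g hf hg
    refine hf.of_isClosed_subset ?_ (Function.support_mul_subset_left f g)
    exact ((f * g).isLocallyConstant.isClopen_fiber 0).compl.isClosed
  smul_mem' := by
    intro c f hf
    refine hf.of_isClosed_subset ?_ (Function.support_const_smul_subset c f)
    exact ((c • f).isLocallyConstant.isClopen_fiber 0).compl.isClosed

namespace ArrowGroupoid

variable {G : Type*} [TopologicalSpace G] [ArrowGroupoid G]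

section

variable {R : Type*} [CommRing R]

theorem ext_lc {f g : LcFun (units G) R} (h : ∀ x, f.1 x = g.1 x) : f = g :=
  Subtype.ext (LocallyConstant.ext h)

open scoped Classical in
/-- For a function `f` on `G⁽⁰⁾` and a bisection `B`, the function sending `r(b)` to `f(s(b))` for
`b ∈ B`, and vanishing off `r(B)`; that is, `f ∘ θ_{B⁻¹}` extended by zero, where
`θ_{B⁻¹} : r(B) → s(B)` maps `r(b)` to `s(b)`. -/
noncomputable def actFun (B : Set G) (f : units G → R) (x : units G) : R :=
  if h : ∃ b ∈ B, rngMap b = x then f (srcMap h.choose) else 0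

theorem actFun_rngMap {B : Set G} (hB : IsBisection B) (f : units G → R) {b : G} (hb : b ∈ B) :
    actFun B f (rngMap b) = f (srcMap b) := by
  have h : ∃ b' ∈ B, rngMap b' = rngMap b := ⟨b, hb, rfl⟩
  have h2 := h.choose_spec
  rw [actFun, dif_pos h, hB.1 h2.1 hb (congrArg Subtype.val h2.2)]

theorem actFun_of_notMem {B : Set G} (f : units G → R) {x : units G}
    (hx : x ∉ rngMap '' B) : actFun B f x = 0 := by
  rw [actFun, dif_neg]
  rintro ⟨b, hb, h⟩
  exact hx ⟨b, hb, h⟩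

variable (R) in
/-- The ideal `D_B` of functions supported in `r(B)`. -/
def supportIdeal (B : CompactBisection G) : TwoSidedIdeal (LcFun (units G) R) :=
  TwoSidedIdeal.mk' {f | Function.support f.1 ⊆ rngMap '' B.1}
    (by
      intro x hx
      exact absurd rfl hx)
    (by
      intro f g hf hg x hx
      by_contra h
      have h1 : f.1 x = 0 := by
        by_contra h1
        exact h (hf h1)
      have h2 : g.1 x = 0 := by
        by_contra h2
        exact h (hg h2)
      refine hx ?_
      change f.1 x + g.1 x = 0
      rw [h1, h2, add_zero])
    (by
      intro f hf x hx
      refine hf fun h => hx ?_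
      change -f.1 x = 0
      rw [h, neg_zero])
    (by
      intro f g hg x hx
      refine hg fun h => hx ?_
      change f.1 x * g.1 x = 0
      rw [h, mul_zero])
    (by
      intro f g hf x hx
      refine hf fun h => hx ?_
      change f.1 x * g.1 x = 0
      rw [h, zero_mul])

theorem mem_supportIdeal {B : CompactBisection G} {f : LcFun (units G) R} :
    f ∈ supportIdeal R B ↔ Function.support f.1 ⊆ rngMap '' B.1 :=
  TwoSidedIdeal.mem_mk' ..

theorem mem_supportIdeal_iff {B : CompactBisection G} {f : LcFun (units G) R} :
    f ∈ supportIdeal R B ↔ ∀ x, x ∉ rngMap '' B.1 → f.1 x = 0 := by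
  rw [mem_supportIdeal]
  constructor
  · intro h x hx
    by_contra h'
    exact hx (h h')
  · intro h x hx
    by_contra h'
    exact hx (h x h')

variable [T2Space G] [IsAmple G]

theorem isClopen_rngMap_image (B : CompactBisection G) :
    IsClopen (rngMap '' B.1 : Set (units G)) :=
  ⟨(B.2.2.1.image isLocalHomeomorph_rngMap.continuous).isClosed,
    isLocalHomeomorph_rngMap.isOpenMap _ B.2.1⟩

theorem isLocallyConstant_actFun (B : CompactBisection G) (f : LocallyConstant (units G) R) :
    IsLocallyConstant (actFun B.1 f) := by
  let : TopologicalSpace R := ⊥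
  have : DiscreteTopology R := ⟨rfl⟩
  rw [IsLocallyConstant.iff_continuous, continuous_iff_continuousAt]
  intro x
  by_cases hx : x ∈ rngMap '' B.1
  · obtain ⟨b, hb, rfl⟩ := hx
    have hE := isOpenEmbedding_rngMap B.2.1 B.2.2.2.1
    have h := hE.continuousAt_iff (g := actFun B.1 f) (x := ⟨b, hb⟩)
    refine h.1 ?_
    have hfun : (actFun B.1 f ∘ fun b : B.1 => rngMap (b : G)) =
        f ∘ (srcMap ∘ (Subtype.val : B.1 → G)) := by
      funext c
      exact actFun_rngMap B.2.2.2 f c.2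
    rw [hfun]
    exact (f.continuous.comp ((IsEtale.isLocalHomeomorph_srcMap (G := G)).continuous.comp
      continuous_subtype_val)).continuousAt
  · have hev : actFun B.1 f =ᶠ[𝓝 x] fun _ => 0 := by
      filter_upwards [(isClopen_rngMap_image B).compl.isOpen.mem_nhds hx] with y hy
      exact actFun_of_notMem _ hy
    exact hev.continuousAt

/-- The map `f ↦ f ∘ θ_{B⁻¹}` (extended by zero off `r(B)`). On functions supported in `s(B)` this
is the isomorphism `α_B : D_{B⁻¹} → D_B`. -/
noncomputable def act (B : CompactBisection G) (f : LcFun (units G) R) : LcFun (units G) R :=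
  ⟨⟨actFun B.1 f.1, isLocallyConstant_actFun B f.1⟩, by
    refine (B.2.2.1.image isLocalHomeomorph_rngMap.continuous).of_isClosed_subset
      ((isLocallyConstant_actFun B f.1).isClopen_fiber 0).compl.isClosed ?_
    intro x hx
    by_contra h
    exact hx (actFun_of_notMem _ h)⟩

theorem act_rngMap (B : CompactBisection G) (f : LcFun (units G) R) {b : G} (hb : b ∈ B.1) :
    (act B f).1 (rngMap b) = f.1 (srcMap b) :=
  actFun_rngMap B.2.2.2 f.1 hb

theorem act_of_notMem (B : CompactBisection G) (f : LcFun (units G) R) {x : units G}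
    (hx : x ∉ rngMap '' B.1) : (act B f).1 x = 0 :=
  actFun_of_notMem _ hx

theorem act_mem (B : CompactBisection G) (f : LcFun (units G) R) : act B f ∈ supportIdeal R B :=
  mem_supportIdeal_iff.2 fun _ hx => act_of_notMem B f hx

theorem act_mul (B C : CompactBisection G) (f : LcFun (units G) R) :
    act B (act C f) = act (B * C) f := by
  refine ext_lc fun x => ?_
  by_cases hx : x ∈ rngMap '' B.1
  · obtain ⟨b, hb, rfl⟩ := hx
    rw [act_rngMap B _ hb]
    by_cases hc : srcMap b ∈ rngMap '' C.1
    · obtain ⟨c, hc, h⟩ := hc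
      have h' : src b = rng c := (congrArg Subtype.val h).symm
      have hbc : b * c ∈ (B * C).1 := ⟨b, hb, c, hc, h', rfl⟩
      have e1 : rngMap b = rngMap (b * c) := Subtype.ext (rng_mul _ _ h').symm
      have e2 : srcMap c = srcMap (b * c) := Subtype.ext (src_mul _ _ h').symm
      rw [← h, act_rngMap C _ hc, e1, act_rngMap _ _ hbc, e2]
    · rw [act_of_notMem C _ hc, act_of_notMem]
      rintro ⟨_, ⟨b', hb', c, hc', h, rfl⟩, e⟩
      have e' : rng b' = rng b := by
        rw [← rng_mul _ _ h]
        exact congrArg Subtype.val e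
      obtain rfl := B.2.2.2.1 hb' hb e'
      exact hc ⟨c, hc', Subtype.ext h.symm⟩
  · rw [act_of_notMem B _ hx, act_of_notMem]
    rintro ⟨_, ⟨b', hb', c, hc', h, rfl⟩, rfl⟩
    exact hx ⟨b', hb', Subtype.ext (rng_mul _ _ h).symm⟩

theorem act_inv_act (B : CompactBisection G) {f : LcFun (units G) R}
    (hf : f ∈ supportIdeal R B⁻¹) : act B⁻¹ (act B f) = f := by
  refine ext_lc fun x => ?_
  by_cases hx : x ∈ rngMap '' (B⁻¹).1
  · obtain ⟨_, ⟨b, hb, rfl⟩, rfl⟩ := hx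
    have e1 : srcMap b⁻¹ = rngMap b := Subtype.ext (src_inv b)
    have e2 : rngMap b⁻¹ = srcMap b := Subtype.ext (rng_inv b)
    rw [act_rngMap B⁻¹ _ ⟨b, hb, rfl⟩, e1, act_rngMap B _ hb, e2]
  · rw [act_of_notMem _ _ hx, mem_supportIdeal_iff.1 hf x hx]

theorem act_act_inv (B : CompactBisection G) {f : LcFun (units G) R}
    (hf : f ∈ supportIdeal R B) : act B (act B⁻¹ f) = f := by
  have h := act_inv_act B⁻¹ (f := f) (by rwa [PartialAction.inv_inv'])
  rwa [PartialAction.inv_inv'] at h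

theorem mem_supportIdeal_mul_iff (B C : CompactBisection G) {f : LcFun (units G) R}
    (hf : f ∈ supportIdeal R B⁻¹) :
    act B f ∈ supportIdeal R (B * C) ↔ f ∈ supportIdeal R C := by
  simp only [mem_supportIdeal_iff]
  constructor
  · intro h x hx
    by_cases hx' : x ∈ rngMap '' (B⁻¹).1
    · obtain ⟨_, ⟨b, hb, rfl⟩, rfl⟩ := hx'
      have e2 : rngMap b⁻¹ = srcMap b := Subtype.ext (rng_inv b)
      rw [e2] at hx ⊢
      rw [← act_rngMap B f hb]
      apply h
      rintro ⟨_, ⟨b', hb', c, hc', h, rfl⟩, e⟩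
      have e' : rng b' = rng b := by
        rw [← rng_mul _ _ h]
        exact congrArg Subtype.val e
      obtain rfl := B.2.2.2.1 hb' hb e'
      exact hx ⟨c, hc', Subtype.ext h.symm⟩
    · exact mem_supportIdeal_iff.1 hf x hx'
  · intro h x hx
    by_cases hx' : x ∈ rngMap '' B.1
    · obtain ⟨b, hb, rfl⟩ := hx'
      rw [act_rngMap B f hb]
      apply h
      rintro ⟨c, hc, e⟩
      have h' : src b = rng c := (congrArg Subtype.val e).symm
      exact hx ⟨b * c, ⟨b, hb, c, hc, h', rfl⟩, Subtype.ext (rng_mul _ _ h')⟩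
    · exact act_of_notMem B f hx'

theorem exists_idempotent (f : LcFun (units G) R) :
    ∃ U : CompactBisection G, IsIdempotentElem U ∧ f ∈ supportIdeal R U := by
  have hsub : Subtype.val '' Function.support f.1 ⊆ units G := by
    rintro _ ⟨u, -, rfl⟩
    exact u.2
  have hrng : ∀ u ∈ units G, rng u = u := by
    intro u hu
    have h := rng_src u
    rwa [show src u = u from hu] at h
  have hsrc : ∀ u ∈ units G, src u = u := fun u hu => hu
  have ho : IsOpen (Subtype.val '' Function.support f.1 : Set G) :=
    isOpen_units.isOpenEmbedding_subtypeVal.isOpenMap _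
      (f.1.isLocallyConstant.isClopen_fiber 0).compl.isOpen
  have hk : IsCompact (Subtype.val '' Function.support f.1 : Set G) :=
    IsCompact.image f.2 continuous_subtype_val
  have hb : IsBisection (Subtype.val '' Function.support f.1 : Set G) := by
    constructor
    · intro a ha b hb h
      rwa [hrng a (hsub ha), hrng b (hsub hb)] at h
    · intro a ha b hb h
      rwa [hsrc a (hsub ha), hsrc b (hsub hb)] at h
  refine ⟨⟨_, ho, hk, hb⟩, ?_, ?_⟩
  · refine Subtype.ext ?_
    ext x
    constructor
    · rintro ⟨b, hb, c, hc, h, rfl⟩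
      rw [hsrc b (hsub hb), hrng c (hsub hc)] at h
      obtain rfl := h
      have h2 := mul_src b
      rw [hsrc b (hsub hb)] at h2
      rwa [h2]
    · intro hx
      have h2 := mul_src x
      rw [hsrc x (hsub hx)] at h2
      exact ⟨x, hx, x, hx, by rw [hsrc x (hsub hx), hrng x (hsub hx)], h2.symm⟩
  · refine mem_supportIdeal.2 ?_
    intro u hu
    exact ⟨u, ⟨u, hu, rfl⟩, Subtype.ext (hrng u u.2)⟩

end

section

variable (G) (R : Type*) [CommRing R] [T2Space G] [IsAmple G]

/-- The action `α` of `Gᵃ` on `𝓛_c(G⁽⁰⁾)`. -/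
noncomputable def bisectionAction : PartialAction (CompactBisection G) (LcFun (units G) R) where
  D := supportIdeal R
  π := act
  bijOn B := by
    refine ⟨fun f _ => act_mem B f, ?_, ?_⟩
    · intro f hf g hg h
      rw [← act_inv_act B hf, ← act_inv_act B hg, h]
    · intro f hf
      exact ⟨act B⁻¹ f, act_mem B⁻¹ f, act_act_inv B hf⟩
  π_add B f _ g _ := by
    refine ext_lc fun x => ?_
    change _ = (act B f).1 x + (act B g).1 x
    by_cases hx : x ∈ rngMap '' B.1
    · obtain ⟨b, hb, rfl⟩ := hx
      rw [act_rngMap B _ hb, act_rngMap B _ hb, act_rngMap B _ hb]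
      rfl
    · rw [act_of_notMem B _ hx, act_of_notMem B _ hx, act_of_notMem B _ hx, add_zero]
  π_mul B f _ g _ := by
    refine ext_lc fun x => ?_
    change _ = (act B f).1 x * (act B g).1 x
    by_cases hx : x ∈ rngMap '' B.1
    · obtain ⟨b, hb, rfl⟩ := hx
      rw [act_rngMap B _ hb, act_rngMap B _ hb, act_rngMap B _ hb]
      rfl
    · rw [act_of_notMem B _ hx, act_of_notMem B _ hx, act_of_notMem B _ hx, mul_zero]
  generates := by
    rw [eq_top_iff]
    intro f _
    obtain ⟨U, hU, hf⟩ := exists_idempotent f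
    exact AddSubgroup.subset_closure (mem_biUnion (show U ∈ {e | IsIdempotentElem e} from hU) hf)
  image_inter B C := by
    ext f
    constructor
    · rintro ⟨g, ⟨hg, hg'⟩, rfl⟩
      exact ⟨act_mem B g, (mem_supportIdeal_mul_iff B C hg).2 hg'⟩
    · rintro ⟨hf, hf'⟩
      refine ⟨act B⁻¹ f, ⟨act_mem B⁻¹ f, ?_⟩, act_act_inv B hf⟩
      refine (mem_supportIdeal_mul_iff B C (act_mem B⁻¹ f)).1 ?_
      rw [act_act_inv B hf]
      exact hf'
  π_comp B C f _ _ := act_mul B C f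

/-- The skew inverse semigroup ring `𝓛_c(G⁽⁰⁾) ⋊ Gᵃ`. -/
abbrev GroupoidSkewRing : Type _ := (bisectionAction G R).SkewRing

/-- The diagonal of `𝓛_c(G⁽⁰⁾) ⋊ Gᵃ`. -/
abbrev diagonal : Set (GroupoidSkewRing G R) := (bisectionAction G R).diagonal

end

end ArrowGroupoid

/-! ### Formal sums and their classes. -/

namespace PartialAction

variable {S : Type*} [InverseSemigroup S] {A : Type*} [NonUnitalRing A] (P : PartialAction S A)

/-! The skew ring is a ring of functions on the groupoid. Send `f δ_B` to the function on `G` equal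
to `f ∘ r` on `B` and zero elsewhere (`evalHom`). The defining product becomes convolution. This is
needed only with one factor homogeneous, where a bisection leaves at most one term in the
convolution sum, so general convolution never has to be defined.

The crux is `mem_relIdeal_iff`: the ideal `𝓝` is exactly the kernel of `evalHom`. The kernel is a
two-sided ideal containing the generators. Conversely, if a formal sum evaluates to zero, then
wherever one term is nonzero another term must cancel it, so that term can be cut along
intersections of bisections and absorbed, modulo `𝓝`, into the others; the number of terms drops and
induction finishes. Hence equations between classes can be checked pointwise on `G`.

In this picture `𝓓` is the set of represented functions that vanish off the units, which gives the
embedding of `𝓛_c(G⁽⁰⁾)`. Multiplying by a diagonal element on the left or right scales the value at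
`a` by `f(r(a))` or `f(s(a))`. Since such `f` separate units, the centralizer of `𝓓` consists of the
functions supported in the isotropy. Supports are open, so they lie in its interior, and
effectiveness puts them in the units. Conversely, an arrow interior to the isotropy has a compact
open bisection around it inside the isotropy, whose indicator centralizes `𝓓`; it lies in `𝓓` only
if the arrow is a unit. -/

theorem FormalSum.induction {P : PartialAction S A} {p : P.FormalSum → Prop} (x : P.FormalSum)
    (zero : p 0) (delta : ∀ s a, p (P.delta s a)) (add : ∀ x y, p x → p y → p (x + y)) : p x := by
  classical
  refine DirectSum.induction_on x zero (fun s a => ?_) add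
  exact delta s a

/-- Each index occurs only once here, so the kernel computation can induct on the set of indices. -/
theorem FormalSum.exists_eq_sum {P : PartialAction S A} (x : P.FormalSum) :
    ∃ (t : Finset S) (a : ∀ s, P.D s), x = ∑ s ∈ t, P.delta s (a s) := by
  classical
  refine ⟨DFinsupp.support (β := fun s => P.D s) x,
    fun s => DFunLike.coe (F := DirectSum S fun s => P.D s) x s, ?_⟩
  refine (DirectSum.sum_support_of (β := fun s => P.D s) x).symm.trans ?_
  refine Finset.sum_congr rfl fun s _ => ?_
  unfold PartialAction.delta
  congr!

/-- The class in `A ⋊ S` of a formal sum. -/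
noncomputable def toSkew (x : P.FormalSum) : P.SkewRing := (x : P.relIdeal.ringCon.Quotient)

theorem toSkew_eq_toSkew_iff {x y : P.FormalSum} : P.toSkew x = P.toSkew y ↔ x - y ∈ P.relIdeal := by
  rw [toSkew, toSkew, RingCon.eq, TwoSidedIdeal.rel_iff]

theorem toSkew_surjective : Function.Surjective P.toSkew := Quotient.mk_surjective

theorem toSkew_mul (x y : P.FormalSum) : P.toSkew (x * y) = P.toSkew x * P.toSkew y := rfl

theorem toSkew_add (x y : P.FormalSum) : P.toSkew (x + y) = P.toSkew x + P.toSkew y := rfl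

theorem toSkew_zero : P.toSkew 0 = 0 := rfl

theorem toSkew_sum {ι : Type*} (t : Finset ι) (x : ι → P.FormalSum) :
    P.toSkew (∑ i ∈ t, x i) = ∑ i ∈ t, P.toSkew (x i) :=
  map_sum (AddMonoidHom.mk' P.toSkew P.toSkew_add) x t

theorem deltaBar_eq_toSkew (s : S) (a : P.D s) : P.deltaBar s a = P.toSkew (P.delta s a) := rfl

end PartialAction

/-! ### Units, restriction of functions, and the natural order. -/

namespace ArrowGroupoid

section

variable {G : Type*} [ArrowGroupoid G]

theorem rng_eq_self_of_mem_units {u : G} (hu : u ∈ units G) : rng u = u := by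
  have h := rng_src u
  rwa [show src u = u from hu] at h

theorem src_eq_self_of_mem_units {u : G} (hu : u ∈ units G) : src u = u := hu

theorem rngMap_unit (u : units G) : rngMap (u : G) = u :=
  Subtype.ext (rng_eq_self_of_mem_units u.2)

theorem mul_inv_cancel_right' {a c : G} (h : src a = src c) : a * c⁻¹ * c = a := by
  rw [assoc _ _ _ (by rw [h, rng_inv]) (src_inv c), inv_mul_self, ← h, mul_src]

theorem units_subset_iso : units G ⊆ iso G := fun _ hu =>
  (rng_eq_self_of_mem_units hu).trans (src_eq_self_of_mem_units hu).symm

end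

variable {G : Type*} [TopologicalSpace G] [ArrowGroupoid G]

section

variable {R : Type*} [CommRing R]

/-- The restriction of `f` to a clopen set, extended by zero. -/
noncomputable def restrict {K : Set (units G)} (hK : IsClopen K) (f : LcFun (units G) R) :
    LcFun (units G) R :=
  ⟨f.1.indicator hK, by
    refine f.2.of_isClosed_subset
      ((f.1.indicator hK).isLocallyConstant.isClopen_fiber 0).compl.isClosed ?_
    intro x hx hx'
    refine hx ?_
    rw [LocallyConstant.indicator_apply]
    exact indicator_apply_eq_zero.2 fun _ => hx'⟩

theorem restrict_of_mem {K : Set (units G)} (hK : IsClopen K) (f : LcFun (units G) R)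
    {x : units G} (hx : x ∈ K) : (restrict hK f).1 x = f.1 x :=
  (LocallyConstant.indicator_apply f.1 hK x).trans (indicator_of_mem hx _)

theorem restrict_of_notMem {K : Set (units G)} (hK : IsClopen K) (f : LcFun (units G) R)
    {x : units G} (hx : x ∉ K) : (restrict hK f).1 x = 0 :=
  (LocallyConstant.indicator_apply f.1 hK x).trans (indicator_of_notMem hx _)

theorem restrict_add_restrict_compl {K : Set (units G)} (hK : IsClopen K)
    (f : LcFun (units G) R) : restrict hK f + restrict hK.compl f = f := by
  refine ext_lc fun x => ?_
  change (restrict hK f).1 x + (restrict hK.compl f).1 x = f.1 x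
  by_cases hx : x ∈ K
  · rw [restrict_of_mem hK f hx, restrict_of_notMem hK.compl f (fun h => h hx), add_zero]
  · rw [restrict_of_notMem hK f hx, restrict_of_mem hK.compl f hx, zero_add]

theorem restrict_mem {K : Set (units G)} (hK : IsClopen K) {f : LcFun (units G) R}
    {B : CompactBisection G} (hf : f ∈ supportIdeal R B) :
    restrict hK f ∈ supportIdeal R B := by
  rw [mem_supportIdeal_iff] at hf ⊢
  intro x hx
  by_cases hx' : x ∈ K
  · rw [restrict_of_mem hK f hx', hf x hx]
  · exact restrict_of_notMem hK f hx'

/-- As `r` is injective on `C`, having `r(c) ∈ r(B)` would force `c ∈ B`. -/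
theorem apply_rngMap_eq_zero {B C : CompactBisection G} (h : B.1 ⊆ C.1)
    {f : LcFun (units G) R} (hf : f ∈ supportIdeal R B) {c : G} (hc : c ∈ C.1) (hc' : c ∉ B.1) :
    f.1 (rngMap c) = 0 := by
  refine mem_supportIdeal_iff.1 hf _ ?_
  rintro ⟨b, hb, e⟩
  obtain rfl := C.2.2.2.1 (h hb) hc (congrArg Subtype.val e)
  exact hc' hb

end

variable [T2Space G] [IsAmple G]

/-- In a composable product `c b⁻¹ d` with `c ∈ C` and `b, d ∈ B`, injectivity of `r` and `s` forces
`c = b = d`, so the product is `b`. -/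
theorem natLE_of_subset {B C : CompactBisection G} (h : B.1 ⊆ C.1) :
    InverseSemigroup.NatLE B C := by
  refine Subtype.ext ?_
  rw [CompactBisection.coe_mul, CompactBisection.coe_mul, CompactBisection.coe_inv]
  ext x
  constructor
  · intro hx
    exact ⟨rng x, ⟨x, h hx, x⁻¹, ⟨x, hx, rfl⟩, (rng_inv x).symm, (mul_inv_self x).symm⟩, x, hx,
      src_rng x, (rng_mul_self x).symm⟩
  · rintro ⟨_, ⟨c, hc, _, ⟨b, hb, rfl⟩, h1, rfl⟩, d, hd, h2, rfl⟩
    rw [src_mul _ _ h1, src_inv] at h2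
    obtain rfl := B.2.2.2.1 hb hd h2
    rw [rng_inv] at h1
    obtain rfl := C.2.2.2.2 hc (h hb) h1
    rwa [mul_inv_self, rng_mul_self]

theorem subset_of_natLE {B C : CompactBisection G} (h : InverseSemigroup.NatLE B C) :
    B.1 ⊆ C.1 := by
  intro x hx
  have h' : B.1 = setMul (setMul C.1 (setInv B.1)) B.1 := congrArg Subtype.val h
  rw [h'] at hx
  obtain ⟨_, ⟨c, hc, _, ⟨b, hb, rfl⟩, h1, rfl⟩, d, hd, h2, rfl⟩ := hx
  rw [src_mul _ _ h1, src_inv] at h2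
  obtain rfl := B.2.2.2.1 hb hd h2
  rw [assoc _ _ _ h1 (src_inv b), inv_mul_self, ← rng_inv, ← h1, mul_src]
  exact hc

/-- The intersection of two compact open bisections. -/
def CompactBisection.inter (B C : CompactBisection G) : CompactBisection G :=
  ⟨B.1 ∩ C.1, B.2.1.inter C.2.1, B.2.2.1.inter C.2.2.1, B.2.2.2.1.mono inter_subset_left,
    B.2.2.2.2.mono inter_subset_left⟩

/-- If `u = bc` with `u, b, c ∈ U`, comparing ranges and sources gives `b = u = c`. Thus `u = uu`,
and cancelling makes `u` a unit. -/
theorem subset_units_of_isIdempotentElem {U : CompactBisection G} (hU : IsIdempotentElem U) :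
    U.1 ⊆ units G := by
  intro u hu
  have h : setMul U.1 U.1 = U.1 := congrArg Subtype.val hU
  have hu' := hu
  rw [← h] at hu'
  obtain ⟨b, hb, c, hc, h1, rfl⟩ := hu'
  have h2 := U.2.2.2.1 hu hb (rng_mul _ _ h1)
  have h3 := inv_mul_cancel_left' b c h1
  rw [h2, inv_mul_self] at h3
  rw [h2]
  have h4 := U.2.2.2.2 hu hc (src_mul _ _ h1)
  rw [h2] at h4
  rw [← h4] at h3
  exact h3

/-! ### The function on `G` represented by a formal sum. -/

section

variable {R : Type*} [CommRing R]

/-- The additive map sending `f ∈ D_B` to the function equal to `f ∘ r` on `B` and vanishing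
off `B`. -/
noncomputable def indicatorHom (B : CompactBisection G) : (bisectionAction G R).D B →+ (G → R) :=
  AddMonoidHom.mk' (fun f => B.1.indicator fun a => f.1.1 (rngMap a)) (by
    intro f g
    funext a
    by_cases ha : a ∈ B.1
    · simp only [Pi.add_apply, indicator_of_mem ha]
      rfl
    · simp only [Pi.add_apply, indicator_of_notMem ha, add_zero])

open scoped Classical in
/-- The function `G → R` represented by a formal sum: `f δ_B` is sent to the function equal to
`f ∘ r` on `B` and vanishing off `B`. -/
noncomputable def evalHom : (bisectionAction G R).FormalSum →+ (G → R) :=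
  DirectSum.toAddMonoid (β := fun B => (bisectionAction G R).D B) indicatorHom

theorem evalHom_delta (B : CompactBisection G) (f : (bisectionAction G R).D B) :
    evalHom ((bisectionAction G R).delta B f) = B.1.indicator fun a => f.1.1 (rngMap a) := by
  classical
  exact DirectSum.toAddMonoid_of (β := fun B => (bisectionAction G R).D B) indicatorHom B f

theorem evalHom_delta_of_mem {B : CompactBisection G} (f : (bisectionAction G R).D B) {a : G}
    (ha : a ∈ B.1) : evalHom ((bisectionAction G R).delta B f) a = f.1.1 (rngMap a) := by
  rw [evalHom_delta, indicator_of_mem ha]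

theorem evalHom_delta_of_notMem {B : CompactBisection G} (f : (bisectionAction G R).D B) {a : G}
    (ha : a ∉ B.1) : evalHom ((bisectionAction G R).delta B f) a = 0 := by
  rw [evalHom_delta, indicator_of_notMem ha]

/-- The coefficient `α_B(α_{B*}(f) g)` at `r(b)` is `α_{B*}(f) g` at `s(b) = r(c)`, and there
`α_{B*}(f)` returns `f(r(b))`. -/
theorem evalHom_delta_mul_delta {B C : CompactBisection G} (f : (bisectionAction G R).D B)
    (g : (bisectionAction G R).D C) {b c : G} (hb : b ∈ B.1) (hc : c ∈ C.1) (h : src b = rng c) :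
    evalHom ((bisectionAction G R).delta B f * (bisectionAction G R).delta C g) (b * c) =
      f.1.1 (rngMap b) * g.1.1 (rngMap c) := by
  rw [PartialAction.delta_mul_delta, evalHom_delta_of_mem (B := B * C) _ ⟨b, hb, c, hc, h, rfl⟩]
  have e1 : rngMap (b * c) = rngMap b := Subtype.ext (rng_mul _ _ h)
  have e2 : srcMap b = rngMap c := Subtype.ext h
  have e3 : rngMap b⁻¹ = srcMap b := Subtype.ext (rng_inv b)
  have e4 : srcMap b⁻¹ = rngMap b := Subtype.ext (src_inv b)
  rw [e1]
  change (act B (act B⁻¹ f.1 * g.1)).1 (rngMap b) = _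
  rw [act_rngMap B _ hb]
  change (act B⁻¹ f.1).1 (srcMap b) * g.1.1 (srcMap b) = _
  rw [e2]
  congr 1
  rw [← e2, ← e3, act_rngMap B⁻¹ _ (mem_setInv.2 (by rwa [inv_inv'])), e4]

theorem evalHom_delta_mul_delta_of_notMem {B C : CompactBisection G}
    (f : (bisectionAction G R).D B) (g : (bisectionAction G R).D C) {a : G}
    (ha : a ∉ setMul B.1 C.1) :
    evalHom ((bisectionAction G R).delta B f * (bisectionAction G R).delta C g) a = 0 := by
  rw [PartialAction.delta_mul_delta]
  exact evalHom_delta_of_notMem _ ha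

/-- Only one arrow of `B` has range `r(a)`, so the convolution sum at `a` has a single term. -/
theorem evalHom_delta_mul {B : CompactBisection G} (f : (bisectionAction G R).D B)
    (y : (bisectionAction G R).FormalSum) {a b : G} (hb : b ∈ B.1) (h : rng b = rng a) :
    evalHom ((bisectionAction G R).delta B f * y) a =
      f.1.1 (rngMap b) * evalHom y (b⁻¹ * a) := by
  have hs : src b = rng (b⁻¹ * a) := by rw [rng_mul _ _ (by rw [src_inv, h]), rng_inv]
  induction y using PartialAction.FormalSum.induction with
  | zero => rw [mul_zero, map_zero, Pi.zero_apply, Pi.zero_apply, mul_zero]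
  | delta C g =>
    by_cases hc : b⁻¹ * a ∈ C.1
    · have e := evalHom_delta_mul_delta f g hb hc hs
      rw [mul_inv_cancel_left' _ _ h] at e
      rw [e, evalHom_delta_of_mem g hc]
    · rw [evalHom_delta_of_notMem g hc, mul_zero]
      refine evalHom_delta_mul_delta_of_notMem f g ?_
      rintro ⟨b', hb', c, hc', h', rfl⟩
      rw [rng_mul _ _ h'] at h
      obtain rfl := B.2.2.2.1 hb hb' h
      rw [inv_mul_cancel_left' _ _ h'] at hc
      exact hc hc'
  | add x y hx hy =>
    rw [mul_add, map_add, map_add, Pi.add_apply, Pi.add_apply, hx, hy, mul_add]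

theorem evalHom_delta_mul_of_notMem {B : CompactBisection G} (f : (bisectionAction G R).D B)
    (y : (bisectionAction G R).FormalSum) {a : G} (h : ∀ b ∈ B.1, rng b ≠ rng a) :
    evalHom ((bisectionAction G R).delta B f * y) a = 0 := by
  induction y using PartialAction.FormalSum.induction with
  | zero => rw [mul_zero, map_zero, Pi.zero_apply]
  | delta C g =>
    refine evalHom_delta_mul_delta_of_notMem f g ?_
    rintro ⟨b, hb, c, hc, h', rfl⟩
    exact h b hb (rng_mul _ _ h').symm
  | add x y hx hy => rw [mul_add, map_add, Pi.add_apply, hx, hy, add_zero]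

theorem evalHom_mul_delta {C : CompactBisection G} (g : (bisectionAction G R).D C)
    (x : (bisectionAction G R).FormalSum) {a c : G} (hc : c ∈ C.1) (h : src a = src c) :
    evalHom (x * (bisectionAction G R).delta C g) a =
      evalHom x (a * c⁻¹) * g.1.1 (rngMap c) := by
  have hs : src (a * c⁻¹) = rng c := by rw [src_mul _ _ (by rw [rng_inv, h]), src_inv]
  induction x using PartialAction.FormalSum.induction with
  | zero => rw [zero_mul, map_zero, Pi.zero_apply, Pi.zero_apply, zero_mul]
  | delta B f =>
    by_cases hb : a * c⁻¹ ∈ B.1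
    · have e := evalHom_delta_mul_delta f g hb hc hs
      rw [mul_inv_cancel_right' h] at e
      rw [e, evalHom_delta_of_mem f hb]
    · rw [evalHom_delta_of_notMem f hb, zero_mul]
      refine evalHom_delta_mul_delta_of_notMem f g ?_
      rintro ⟨b, hb', c', hc', h', rfl⟩
      rw [src_mul _ _ h'] at h
      obtain rfl := C.2.2.2.2 hc' hc h
      rw [assoc _ _ _ h' (rng_inv c').symm, mul_inv_self, ← h', mul_src] at hb
      exact hb hb'
  | add x y hx hy =>
    rw [add_mul, map_add, map_add, Pi.add_apply, Pi.add_apply, hx, hy, add_mul]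

theorem evalHom_mul_delta_of_notMem {C : CompactBisection G} (g : (bisectionAction G R).D C)
    (x : (bisectionAction G R).FormalSum) {a : G} (h : ∀ c ∈ C.1, src a ≠ src c) :
    evalHom (x * (bisectionAction G R).delta C g) a = 0 := by
  induction x using PartialAction.FormalSum.induction with
  | zero => rw [zero_mul, map_zero, Pi.zero_apply]
  | delta B f =>
    refine evalHom_delta_mul_delta_of_notMem f g ?_
    rintro ⟨b, hb, c, hc, h', rfl⟩
    exact h c hc (src_mul _ _ h')
  | add x y hx hy => rw [add_mul, map_add, Pi.add_apply, hx, hy, add_zero]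

theorem evalHom_mul_eq_zero_right (x : (bisectionAction G R).FormalSum)
    {y : (bisectionAction G R).FormalSum} (hy : evalHom y = 0) : evalHom (x * y) = 0 := by
  induction x using PartialAction.FormalSum.induction with
  | zero => rw [zero_mul, map_zero]
  | delta B f =>
    funext a
    by_cases h : ∃ b ∈ B.1, rng b = rng a
    · obtain ⟨b, hb, h⟩ := h
      rw [evalHom_delta_mul f y hb h, hy, Pi.zero_apply, mul_zero, Pi.zero_apply]
    · exact evalHom_delta_mul_of_notMem f y fun b hb e => h ⟨b, hb, e⟩
  | add x x' hx hx' => rw [add_mul, map_add, hx, hx', add_zero]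

theorem evalHom_mul_eq_zero_left {x : (bisectionAction G R).FormalSum} (hx : evalHom x = 0)
    (y : (bisectionAction G R).FormalSum) : evalHom (x * y) = 0 := by
  induction y using PartialAction.FormalSum.induction with
  | zero => rw [mul_zero, map_zero]
  | delta C g =>
    funext a
    by_cases h : ∃ c ∈ C.1, src a = src c
    · obtain ⟨c, hc, h⟩ := h
      rw [evalHom_mul_delta g x hc h, hx, Pi.zero_apply, zero_mul, Pi.zero_apply]
    · exact evalHom_mul_delta_of_notMem g x fun c hc e => h ⟨c, hc, e⟩
  | add y y' hy hy' => rw [mul_add, map_add, hy, hy', add_zero]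

theorem evalHom_eq_zero_of_mem_relIdeal {x : (bisectionAction G R).FormalSum}
    (hx : x ∈ (bisectionAction G R).relIdeal) : evalHom x = 0 := by
  -- The kernel is packaged as a two-sided ideal, so only the generators of `𝓝` remain to be tested.
  let I : TwoSidedIdeal (bisectionAction G R).FormalSum :=
    TwoSidedIdeal.mk' {x | evalHom x = 0} (map_zero _)
      (fun {x y} (hx : evalHom x = 0) (hy : evalHom y = 0) =>
        show evalHom (x + y) = 0 by rw [map_add, hx, hy, add_zero])
      (fun {x} (hx : evalHom x = 0) => show evalHom (-x) = 0 by rw [map_neg, hx, neg_zero])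
      (fun {x _} hy => evalHom_mul_eq_zero_right x hy)
      (fun {_ y} hx => evalHom_mul_eq_zero_left hx y)
  have hI : (bisectionAction G R).relIdeal ≤ I := by
    refine TwoSidedIdeal.span_le.2 ?_
    rintro _ ⟨B, C, f, hB, hC, h, rfl⟩
    refine (TwoSidedIdeal.mem_mk' ..).2 ?_
    have hBC := subset_of_natLE h
    change evalHom _ = 0
    rw [map_sub, sub_eq_zero]
    funext a
    by_cases ha : a ∈ B.1
    · rw [evalHom_delta_of_mem _ ha, evalHom_delta_of_mem _ (hBC ha)]
    · rw [evalHom_delta_of_notMem _ ha]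
      by_cases ha' : a ∈ C.1
      · rw [evalHom_delta_of_mem _ ha']
        exact (apply_rngMap_eq_zero hBC hB ha' ha).symm
      · rw [evalHom_delta_of_notMem _ ha']
  exact (TwoSidedIdeal.mem_mk' _ _ _ _ _ _ x).1 (hI hx)

/-! ### The relation ideal is the kernel of evaluation. -/

theorem delta_sub_delta_mem {B C : CompactBisection G} {f : LcFun (units G) R}
    (hB : f ∈ (bisectionAction G R).D B) (hC : f ∈ (bisectionAction G R).D C)
    (h : f ∈ supportIdeal R (B.inter C)) :
    (bisectionAction G R).delta B ⟨f, hB⟩ - (bisectionAction G R).delta C ⟨f, hC⟩ ∈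
      (bisectionAction G R).relIdeal := by
  -- Comparing both terms with `f δ_{B ∩ C}` writes the difference through two generators.
  rw [← sub_sub_sub_cancel_left _ _ ((bisectionAction G R).delta (B.inter C) ⟨f, h⟩)]
  exact TwoSidedIdeal.sub_mem _
    (TwoSidedIdeal.subset_span ⟨_, _, f, h, hC, natLE_of_subset inter_subset_right, rfl⟩)
    (TwoSidedIdeal.subset_span ⟨_, _, f, h, hB, natLE_of_subset inter_subset_left, rfl⟩)

/-- A homogeneous term is redistributed over bisections covering its support. For each `C` in turn,
cut `f` along the clopen set `r(B ∩ C)`: the part inside moves from `B` to `C`, and the part outside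
is left for the remaining bisections. -/
theorem exists_delta_sub_sum_mem (s : Finset (CompactBisection G)) {B : CompactBisection G}
    (f : (bisectionAction G R).D B)
    (h : ∀ b ∈ B.1, f.1.1 (rngMap b) ≠ 0 → ∃ C ∈ s, b ∈ C.1) :
    ∃ k : ∀ C, (bisectionAction G R).D C,
      (bisectionAction G R).delta B f - ∑ C ∈ s, (bisectionAction G R).delta C (k C) ∈
        (bisectionAction G R).relIdeal := by
  classical
  induction s using Finset.induction_on generalizing f with
  | empty =>
    refine ⟨fun _ => 0, ?_⟩
    have hf : f = 0 := by
      refine Subtype.ext (ext_lc fun x => ?_)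
      by_cases hx : x ∈ rngMap '' B.1
      · obtain ⟨b, hb, rfl⟩ := hx
        by_contra hne
        obtain ⟨C, hC, -⟩ := h b hb hne
        exact absurd hC (Finset.notMem_empty C)
      · exact mem_supportIdeal_iff.1 f.2 x hx
    rw [hf, map_zero, Finset.sum_empty, sub_zero]
    exact TwoSidedIdeal.zero_mem _
  | insert C s hC ih =>
    have hK := isClopen_rngMap_image (B.inter C)
    have hBC : restrict hK f.1 ∈ supportIdeal R (B.inter C) :=
      mem_supportIdeal_iff.2 fun x hx => restrict_of_notMem hK f.1 hx
    have hfB : restrict hK f.1 ∈ supportIdeal R B := restrict_mem hK f.2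
    have hfC : restrict hK f.1 ∈ supportIdeal R C :=
      mem_supportIdeal.2 ((mem_supportIdeal.1 hBC).trans (image_mono inter_subset_right))
    have hfB' : restrict hK.compl f.1 ∈ supportIdeal R B := restrict_mem hK.compl f.2
    obtain ⟨k, hk⟩ := ih ⟨restrict hK.compl f.1, hfB'⟩ (by
      intro b hb hne
      have hbK : rngMap b ∈ (rngMap '' (B.inter C).1)ᶜ := by
        by_contra hbK
        exact hne (restrict_of_notMem hK.compl f.1 hbK)
      obtain ⟨C', hC', hbC'⟩ := h b hb
        (fun e => hne ((restrict_of_mem hK.compl f.1 hbK).trans e))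
      -- The remainder vanishes on `r(B ∩ C)`, so the bisection covering `b` cannot be `C` itself.
      rcases Finset.mem_insert.1 hC' with rfl | hC'
      · exact absurd ⟨b, ⟨hb, hbC'⟩, rfl⟩ hbK
      · exact ⟨C', hC', hbC'⟩)
    refine ⟨Function.update k C ⟨restrict hK f.1, hfC⟩, ?_⟩
    have hf' : (bisectionAction G R).delta B f =
        (bisectionAction G R).delta B ⟨restrict hK f.1, hfB⟩ +
          (bisectionAction G R).delta B ⟨restrict hK.compl f.1, hfB'⟩ := by
      rw [← map_add]
      exact congrArg _ (Subtype.ext (restrict_add_restrict_compl hK f.1).symm)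
    have hsum : ∑ C' ∈ s, (bisectionAction G R).delta C'
          (Function.update k C ⟨restrict hK f.1, hfC⟩ C') =
        ∑ C' ∈ s, (bisectionAction G R).delta C' (k C') := by
      refine Finset.sum_congr rfl fun C' hC' => ?_
      rw [Function.update_of_ne (by rintro rfl; exact hC hC')]
    rw [Finset.sum_insert hC, hsum, Function.update_self, hf', add_sub_add_comm]
    exact TwoSidedIdeal.add_mem _ (delta_sub_delta_mem hfB hfC hBC) hk

/-- Where the term at `B` is nonzero, another term must cancel it. So the other bisections cover its
support, and they can absorb it modulo `𝓝`. -/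
theorem sum_delta_mem_relIdeal (s : Finset (CompactBisection G))
    (f : ∀ C, (bisectionAction G R).D C)
    (h : evalHom (∑ C ∈ s, (bisectionAction G R).delta C (f C)) = 0) :
    ∑ C ∈ s, (bisectionAction G R).delta C (f C) ∈ (bisectionAction G R).relIdeal := by
  classical
  induction s using Finset.induction_on generalizing f with
  | empty => exact TwoSidedIdeal.zero_mem _
  | insert B s hB ih =>
    rw [Finset.sum_insert hB] at h ⊢
    obtain ⟨k, hk⟩ := exists_delta_sub_sum_mem s (f B) (by
      intro b hb hne
      by_contra! hs
      refine hne ?_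
      have hb' := congrFun h b
      rw [map_add, Pi.add_apply, evalHom_delta_of_mem _ hb, map_sum, Finset.sum_apply,
        Finset.sum_eq_zero fun C hC => evalHom_delta_of_notMem _ (hs C hC), add_zero] at hb'
      exact hb')
    -- The first bracket lies in `𝓝` and so evaluates to zero; what remains is a vanishing sum over
    -- the smaller set `s`.
    have hsum : (bisectionAction G R).delta B (f B) +
          ∑ C ∈ s, (bisectionAction G R).delta C (f C) =
        ((bisectionAction G R).delta B (f B) - ∑ C ∈ s, (bisectionAction G R).delta C (k C)) +
          ∑ C ∈ s, (bisectionAction G R).delta C (k C + f C) := by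
      simp only [map_add, Finset.sum_add_distrib]
      abel
    rw [hsum] at h ⊢
    rw [map_add, evalHom_eq_zero_of_mem_relIdeal hk, zero_add] at h
    exact TwoSidedIdeal.add_mem _ hk (ih _ h)

theorem mem_relIdeal_iff {x : (bisectionAction G R).FormalSum} :
    x ∈ (bisectionAction G R).relIdeal ↔ evalHom x = 0 := by
  refine ⟨evalHom_eq_zero_of_mem_relIdeal, fun h => ?_⟩
  obtain ⟨s, f, rfl⟩ := PartialAction.FormalSum.exists_eq_sum x
  exact sum_delta_mem_relIdeal s f h

theorem toSkew_eq_toSkew_iff_evalHom {x y : (bisectionAction G R).FormalSum} :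
    (bisectionAction G R).toSkew x = (bisectionAction G R).toSkew y ↔ evalHom x = evalHom y := by
  rw [PartialAction.toSkew_eq_toSkew_iff, mem_relIdeal_iff, map_sub, sub_eq_zero]

end

end ArrowGroupoid

/-! ### Local constancy, compact support, and multiplication by functions on units. -/

namespace ArrowGroupoid

theorem inv_eq_self_of_mem_units {G : Type*} [ArrowGroupoid G] {u : G} (hu : u ∈ units G) :
    u⁻¹ = u := by
  have h := mul_src u⁻¹
  rw [src_inv, rng_eq_self_of_mem_units hu, inv_mul_self, src_eq_self_of_mem_units hu] at h
  exact h.symm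

variable {G : Type*} [TopologicalSpace G] [ArrowGroupoid G] [T2Space G] [IsAmple G]
  {R : Type*} [CommRing R]

theorem isClosed_units : IsClosed (units G) := isClosed_eq continuous_src continuous_id

theorem isLocallyConstant_evalHom (x : (bisectionAction G R).FormalSum) :
    IsLocallyConstant (evalHom x) := by
  induction x using PartialAction.FormalSum.induction with
  | zero =>
    rw [map_zero]
    exact IsLocallyConstant.const 0
  | delta B f =>
    rw [evalHom_delta]
    let g : LocallyConstant G R := ⟨fun a => f.1.1 (rngMap a),
      f.1.1.isLocallyConstant.comp_continuous isLocalHomeomorph_rngMap.continuous⟩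
    -- Here the Hausdorff property of `G` enters: compact bisections are closed, so cutting off at
    -- `B` preserves local constancy.
    have hB : IsClopen B.1 := ⟨B.2.2.1.isClosed, B.2.1⟩
    have h := (g.indicator hB).isLocallyConstant
    convert h using 1
    funext a
    exact (LocallyConstant.indicator_apply g hB a).symm
  | add x y hx hy =>
    rw [map_add]
    exact hx.add hy

theorem exists_isCompact_support_evalHom_subset (x : (bisectionAction G R).FormalSum) :
    ∃ K : Set G, IsCompact K ∧ Function.support (evalHom x) ⊆ K := by
  induction x using PartialAction.FormalSum.induction with
  | zero => exact ⟨∅, isCompact_empty, by rw [map_zero, Function.support_zero]⟩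
  | delta B f =>
    refine ⟨B.1, B.2.2.1, ?_⟩
    rw [evalHom_delta]
    exact support_indicator_subset
  | add x y hx hy =>
    obtain ⟨K, hK, hx⟩ := hx
    obtain ⟨L, hL, hy⟩ := hy
    refine ⟨K ∪ L, hK.union hL, ?_⟩
    rw [map_add]
    exact (Function.support_add _ _).trans (union_subset_union hx hy)

/-- The restriction to the unit space of the function represented by a formal sum. -/
noncomputable def unitsPart (x : (bisectionAction G R).FormalSum) : LcFun (units G) R :=
  ⟨⟨fun u => evalHom x u, (isLocallyConstant_evalHom x).comp_continuous continuous_subtype_val⟩, by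
    obtain ⟨K, hK, hx⟩ := exists_isCompact_support_evalHom_subset x
    refine (isClosed_units.isClosedEmbedding_subtypeVal.isCompact_preimage hK).of_isClosed_subset
      (LocallyConstant.isLocallyConstant _ |>.isClopen_fiber 0).compl.isClosed ?_
    intro u hu
    exact hx hu⟩

/-- The only arrow of `U` that can have range `r(a)` is the unit `r(a)`; if it is not in `U`, then
`f` vanishes there and both sides are zero. -/
theorem evalHom_delta_mul_of_idem {U : CompactBisection G} (hU : IsIdempotentElem U)
    (f : (bisectionAction G R).D U) (x : (bisectionAction G R).FormalSum) (a : G) :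
    evalHom ((bisectionAction G R).delta U f * x) a = f.1.1 (rngMap a) * evalHom x a := by
  have hU := subset_units_of_isIdempotentElem hU
  by_cases ha : rng a ∈ U.1
  · rw [evalHom_delta_mul f x ha (rng_rng a), inv_eq_self_of_mem_units (hU ha), rng_mul_self]
    congr 2
    exact rngMap_unit (rngMap a)
  · rw [mem_supportIdeal_iff.1 f.2, zero_mul]
    · refine evalHom_delta_mul_of_notMem f x ?_
      rintro b hb e
      rw [rng_eq_self_of_mem_units (hU hb)] at e
      exact ha (e ▸ hb)
    · rintro ⟨b, hb, e⟩
      have e' : rng b = rng a := congrArg Subtype.val e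
      rw [rng_eq_self_of_mem_units (hU hb)] at e'
      exact ha (e' ▸ hb)

theorem evalHom_mul_delta_of_idem {U : CompactBisection G} (hU : IsIdempotentElem U)
    (f : (bisectionAction G R).D U) (x : (bisectionAction G R).FormalSum) (a : G) :
    evalHom (x * (bisectionAction G R).delta U f) a = evalHom x a * f.1.1 (srcMap a) := by
  have hU := subset_units_of_isIdempotentElem hU
  by_cases ha : src a ∈ U.1
  · rw [evalHom_mul_delta f x ha (src_src a).symm, inv_eq_self_of_mem_units (hU ha), mul_src]
    congr 2
    exact rngMap_unit (srcMap a)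
  · rw [mem_supportIdeal_iff.1 f.2, mul_zero]
    · refine evalHom_mul_delta_of_notMem f x ?_
      rintro b hb e
      rw [src_eq_self_of_mem_units (hU hb)] at e
      exact ha (e ▸ hb)
    · rintro ⟨b, hb, e⟩
      have e' : rng b = src a := congrArg Subtype.val e
      rw [rng_eq_self_of_mem_units (hU hb)] at e'
      exact ha (e' ▸ hb)

/-- The right side does not involve `U`. This is why the class of `f δ_U` depends on `f` alone and
the choice made in `unitsDelta` is harmless. -/
theorem evalHom_delta_of_idem {U : CompactBisection G} (hU : IsIdempotentElem U)
    (f : (bisectionAction G R).D U) :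
    evalHom ((bisectionAction G R).delta U f) = Function.extend Subtype.val f.1.1 0 := by
  have hU := subset_units_of_isIdempotentElem hU
  funext a
  by_cases ha : a ∈ units G
  · lift a to units G using ha
    rw [Subtype.val_injective.extend_apply]
    by_cases ha' : (a : G) ∈ U.1
    · rw [evalHom_delta_of_mem f ha', rngMap_unit]
    · rw [evalHom_delta_of_notMem f ha', mem_supportIdeal_iff.1 f.2]
      rintro ⟨b, hb, rfl⟩
      refine ha' ?_
      change rng b ∈ U.1
      rwa [rng_eq_self_of_mem_units (hU hb)]
  · rw [evalHom_delta_of_notMem f fun h => ha (hU h), Function.extend_apply', Pi.zero_apply]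
    rintro ⟨u, rfl⟩
    exact ha u.2

/-- A formal sum `f δ_U`, where `U` is an idempotent with `f ∈ D_U`. -/
noncomputable def unitsDelta (f : LcFun (units G) R) : (bisectionAction G R).FormalSum :=
  (bisectionAction G R).delta (exists_idempotent f).choose ⟨f, (exists_idempotent f).choose_spec.2⟩

theorem evalHom_unitsDelta (f : LcFun (units G) R) :
    evalHom (unitsDelta f) = Function.extend Subtype.val f.1 0 :=
  evalHom_delta_of_idem (exists_idempotent f).choose_spec.1 _

theorem evalHom_unitsDelta_coe (f : LcFun (units G) R) (u : units G) :
    evalHom (unitsDelta f) u = f.1 u := by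
  rw [evalHom_unitsDelta, Subtype.val_injective.extend_apply]

theorem evalHom_unitsDelta_of_notMem (f : LcFun (units G) R) {a : G} (ha : a ∉ units G) :
    evalHom (unitsDelta f) a = 0 := by
  rw [evalHom_unitsDelta, Function.extend_apply', Pi.zero_apply]
  rintro ⟨u, rfl⟩
  exact ha u.2

theorem evalHom_unitsDelta_mul (f : LcFun (units G) R) (x : (bisectionAction G R).FormalSum)
    (a : G) : evalHom (unitsDelta f * x) a = f.1 (rngMap a) * evalHom x a :=
  evalHom_delta_mul_of_idem (exists_idempotent f).choose_spec.1 _ x a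

theorem evalHom_mul_unitsDelta (f : LcFun (units G) R) (x : (bisectionAction G R).FormalSum)
    (a : G) : evalHom (x * unitsDelta f) a = evalHom x a * f.1 (srcMap a) :=
  evalHom_mul_delta_of_idem (exists_idempotent f).choose_spec.1 _ x a

theorem evalHom_eq_evalHom_unitsDelta {x : (bisectionAction G R).FormalSum}
    {f : LcFun (units G) R} (h : ∀ u : units G, evalHom x u = f.1 u)
    (h' : ∀ a ∉ units G, evalHom x a = 0) : evalHom x = evalHom (unitsDelta f) := by
  funext a
  by_cases ha : a ∈ units G
  · lift a to units G using ha
    rw [h, evalHom_unitsDelta_coe]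
  · rw [h' a ha, evalHom_unitsDelta_of_notMem f ha]

/-! ### The diagonal embedding. -/

variable (G R) in
/-- The embedding of `𝓛_c(G⁽⁰⁾)` as the diagonal of `𝓛_c(G⁽⁰⁾) ⋊ Gᵃ`. -/
noncomputable def diagonalHom : LcFun (units G) R →ₙ+* GroupoidSkewRing G R where
  toFun f := (bisectionAction G R).toSkew (unitsDelta f)
  map_mul' f g := by
    rw [← PartialAction.toSkew_mul, toSkew_eq_toSkew_iff_evalHom]
    symm
    refine evalHom_eq_evalHom_unitsDelta (fun u => ?_) fun a ha => ?_
    · rw [evalHom_unitsDelta_mul, evalHom_unitsDelta_coe, rngMap_unit]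
      rfl
    · rw [evalHom_unitsDelta_mul, evalHom_unitsDelta_of_notMem g ha, mul_zero]
  map_zero' := by
    rw [← PartialAction.toSkew_zero, toSkew_eq_toSkew_iff_evalHom]
    symm
    refine evalHom_eq_evalHom_unitsDelta (fun u => ?_) fun a ha => ?_
    · rw [map_zero]
      rfl
    · rw [map_zero, Pi.zero_apply]
  map_add' f g := by
    rw [← PartialAction.toSkew_add, toSkew_eq_toSkew_iff_evalHom]
    symm
    refine evalHom_eq_evalHom_unitsDelta (fun u => ?_) fun a ha => ?_
    · rw [map_add, Pi.add_apply, evalHom_unitsDelta_coe, evalHom_unitsDelta_coe]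
      rfl
    · rw [map_add, Pi.add_apply, evalHom_unitsDelta_of_notMem f ha,
        evalHom_unitsDelta_of_notMem g ha, add_zero]

theorem diagonalHom_apply (f : LcFun (units G) R) :
    diagonalHom G R f = (bisectionAction G R).toSkew (unitsDelta f) := rfl

theorem diagonalHom_injective : Function.Injective (diagonalHom G R) := by
  intro f g h
  have h' := toSkew_eq_toSkew_iff_evalHom.1 h
  refine ext_lc fun u => ?_
  rw [← evalHom_unitsDelta_coe, h', evalHom_unitsDelta_coe]

theorem diagonalHom_eq_deltaBar {U : CompactBisection G} (hU : IsIdempotentElem U)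
    (f : (bisectionAction G R).D U) :
    diagonalHom G R f = (bisectionAction G R).deltaBar U f := by
  rw [diagonalHom_apply, PartialAction.deltaBar_eq_toSkew, toSkew_eq_toSkew_iff_evalHom,
    evalHom_unitsDelta, evalHom_delta_of_idem hU]

theorem diagonalHom_mem_diagonal (f : LcFun (units G) R) : diagonalHom G R f ∈ diagonal G R := by
  refine ⟨1, fun _ => (exists_idempotent f).choose,
    fun _ => ⟨f, (exists_idempotent f).choose_spec.2⟩,
    fun _ => (exists_idempotent f).choose_spec.1, ?_⟩
  rw [Fin.sum_univ_one]
  rfl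

/-- Idempotent bisections consist of units, which gives one direction. Conversely, a represented
function vanishing off the units is recovered from its `unitsPart`. -/
theorem toSkew_mem_diagonal_iff {x : (bisectionAction G R).FormalSum} :
    (bisectionAction G R).toSkew x ∈ diagonal G R ↔ ∀ a ∉ units G, evalHom x a = 0 := by
  constructor
  · rintro ⟨n, U, f, hU, h⟩ a ha
    have h' : (bisectionAction G R).toSkew x =
        (bisectionAction G R).toSkew (∑ i, (bisectionAction G R).delta (U i) (f i)) := by
      rw [h, PartialAction.toSkew_sum]
      rfl
    rw [toSkew_eq_toSkew_iff_evalHom.1 h', map_sum, Finset.sum_apply]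
    exact Finset.sum_eq_zero fun i _ => evalHom_delta_of_notMem _ fun hi =>
      ha (subset_units_of_isIdempotentElem (hU i) hi)
  · intro h
    have h' : (bisectionAction G R).toSkew x = diagonalHom G R (unitsPart x) :=
      toSkew_eq_toSkew_iff_evalHom.2 (evalHom_eq_evalHom_unitsDelta (fun _ => rfl) h)
    rw [h']
    exact diagonalHom_mem_diagonal _

theorem range_diagonalHom : range (diagonalHom G R) = diagonal G R := by
  refine Subset.antisymm (range_subset_iff.2 diagonalHom_mem_diagonal) ?_
  intro y hy
  obtain ⟨x, rfl⟩ := PartialAction.toSkew_surjective _ y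
  exact ⟨unitsPart x, (toSkew_eq_toSkew_iff_evalHom.2 (evalHom_eq_evalHom_unitsDelta
    (fun _ => rfl) (toSkew_mem_diagonal_iff.1 hy))).symm⟩

/-! ### The centralizer of the diagonal and effectiveness. -/

theorem toSkew_mem_centralizer_iff {x : (bisectionAction G R).FormalSum} :
    (bisectionAction G R).toSkew x ∈ (diagonal G R).centralizer ↔
      ∀ (f : LcFun (units G) R) (a : G),
        f.1 (rngMap a) * evalHom x a = evalHom x a * f.1 (srcMap a) := by
  rw [mem_centralizer_iff, ← range_diagonalHom, forall_mem_range]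
  refine forall_congr' fun f => ?_
  rw [diagonalHom_apply, ← PartialAction.toSkew_mul, ← PartialAction.toSkew_mul,
    toSkew_eq_toSkew_iff_evalHom, funext_iff]
  refine forall_congr' fun a => ?_
  rw [evalHom_unitsDelta_mul, evalHom_mul_unitsDelta]

variable (R) in
/-- The indicator function of the range of a compact open bisection. -/
noncomputable def rangeIndicator (B : CompactBisection G) : LcFun (units G) R :=
  ⟨(1 : LocallyConstant (units G) R).indicator (isClopen_rngMap_image B), by
    refine (B.2.2.1.image isLocalHomeomorph_rngMap.continuous).of_isClosed_subset
      (LocallyConstant.isLocallyConstant _ |>.isClopen_fiber 0).compl.isClosed ?_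
    intro u hu
    by_contra h
    refine hu ?_
    rw [LocallyConstant.indicator_apply, indicator_of_notMem h]⟩

theorem rangeIndicator_of_mem {B : CompactBisection G} {u : units G} (hu : u ∈ rngMap '' B.1) :
    (rangeIndicator R B).1 u = 1 :=
  (LocallyConstant.indicator_apply _ (isClopen_rngMap_image B) u).trans (indicator_of_mem hu _)

theorem rangeIndicator_of_notMem {B : CompactBisection G} {u : units G}
    (hu : u ∉ rngMap '' B.1) : (rangeIndicator R B).1 u = 0 :=
  (LocallyConstant.indicator_apply _ (isClopen_rngMap_image B) u).trans (indicator_of_notMem hu _)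

theorem rangeIndicator_mem (B : CompactBisection G) :
    rangeIndicator R B ∈ supportIdeal R B :=
  mem_supportIdeal_iff.2 fun _ hx => rangeIndicator_of_notMem hx

/-- The units without `v` form an open set, so a basic compact open bisection around `u` fits
inside. It consists of units, hence equals its own range, and its indicator separates the points. -/
theorem exists_apply_eq_one_and_eq_zero {u v : units G} (h : u ≠ v) :
    ∃ f : LcFun (units G) R, f.1 u = 1 ∧ f.1 v = 0 := by
  have hne : (u : G) ≠ v := fun e => h (Subtype.ext e)
  have hopen : IsOpen (units G ∩ {(v : G)}ᶜ) := isOpen_units.inter isClosed_singleton.isOpen_compl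
  obtain ⟨B, hB, huB, hBsub⟩ :=
    (IsAmple.isTopologicalBasis (G := G)).exists_subset_of_mem_open (a := (u : G))
      (u := units G ∩ {(v : G)}ᶜ) ⟨u.2, hne⟩ hopen
  let C : CompactBisection G := ⟨B, hB⟩
  have huC : u ∈ rngMap '' C.1 := ⟨u, huB, rngMap_unit u⟩
  refine ⟨rangeIndicator R C, rangeIndicator_of_mem huC, rangeIndicator_of_notMem ?_⟩
  rintro ⟨b, hb, rfl⟩
  exact (hBsub hb).2 (rng_eq_self_of_mem_units (hBsub hb).1).symm

theorem diagonal_subset_centralizer : diagonal G R ⊆ (diagonal G R).centralizer := by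
  rw [← range_diagonalHom]
  rintro _ ⟨f, rfl⟩
  rw [mem_centralizer_iff, forall_mem_range]
  intro g
  rw [← map_mul, ← map_mul, mul_comm]

theorem isMaximalCommutative_diagonal_of_isEffective (h : IsEffective G) :
    IsMaximalCommutative (diagonal G R) := by
  refine Subset.antisymm ?_ diagonal_subset_centralizer
  intro y hy
  obtain ⟨x, rfl⟩ := PartialAction.toSkew_surjective _ y
  rw [toSkew_mem_centralizer_iff] at hy
  rw [toSkew_mem_diagonal_iff]
  -- At an arrow with `r(a) ≠ s(a)`, a function equal to 1 at `r(a)` and 0 at `s(a)` turns the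
  -- commutation relation into the vanishing of the value at `a`.
  have hsupp : Function.support (evalHom x) ⊆ iso G := by
    intro a ha
    by_contra hne
    obtain ⟨f, h1, h0⟩ := exists_apply_eq_one_and_eq_zero (R := R) (u := rngMap a) (v := srcMap a)
      fun e => hne (congrArg Subtype.val e)
    have := hy f a
    rw [h1, h0, one_mul, mul_zero] at this
    exact ha this
  have hopen : IsOpen (Function.support (evalHom x)) :=
    ((isLocallyConstant_evalHom x).isClopen_fiber 0).compl.isOpen
  intro a ha
  by_contra hne
  refine ha ?_
  rw [← show interior (iso G) = units G from h]
  exact interior_maximal hsupp hopen hne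

theorem isEffective_of_isMaximalCommutative_diagonal [Nontrivial R]
    (h : IsMaximalCommutative (diagonal G R)) : IsEffective G := by
  refine Subset.antisymm ?_ (interior_maximal units_subset_iso isOpen_units)
  intro b hb
  obtain ⟨B, hB, hbB, hBsub⟩ :=
    (IsAmple.isTopologicalBasis (G := G)).exists_subset_of_mem_open hb isOpen_interior
  let C : CompactBisection G := ⟨B, hB⟩
  -- With this coefficient, `f δ_C` represents the indicator of `C`. It centralizes the diagonal
  -- because `r = s` on `C`, yet takes the value 1 at `b`, so a non-unit `b` would contradict
  -- membership in the diagonal.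
  let f : (bisectionAction G R).D C := ⟨rangeIndicator R C, rangeIndicator_mem C⟩
  have hmem : (bisectionAction G R).toSkew ((bisectionAction G R).delta C f) ∈
      (diagonal G R).centralizer := by
    rw [toSkew_mem_centralizer_iff]
    intro g a
    by_cases ha : a ∈ C.1
    · have hiso : a ∈ iso G := interior_subset (hBsub ha)
      have e : rngMap a = srcMap a := Subtype.ext hiso
      rw [e, mul_comm]
    · rw [evalHom_delta_of_notMem f ha, mul_zero, zero_mul]
  rw [show (diagonal G R).centralizer = diagonal G R from h, toSkew_mem_diagonal_iff] at hmem
  by_contra hne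
  have h0 := hmem b hne
  rw [evalHom_delta_of_mem (B := C) f hbB] at h0
  have h1 : (rangeIndicator R C).1 (rngMap b) = 1 := rangeIndicator_of_mem ⟨b, hbB, rfl⟩
  exact one_ne_zero (h1.symm.trans h0)

end ArrowGroupoid

theorem proposition5p4 {G : Type*} [TopologicalSpace G] [T2Space G] [ArrowGroupoid G]
    [ArrowGroupoid.IsAmple G] {R : Type*} [CommRing R] [Nontrivial R] :
    (∃ φ : LcFun (ArrowGroupoid.units G) R →ₙ+* ArrowGroupoid.GroupoidSkewRing G R,
      Function.Injective φ ∧ Set.range φ = ArrowGroupoid.diagonal G R ∧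
      ∀ (U : ArrowGroupoid.CompactBisection G), IsIdempotentElem U →
        ∀ f : (ArrowGroupoid.bisectionAction G R).D U,
          φ f = (ArrowGroupoid.bisectionAction G R).deltaBar U f) ∧
    (ArrowGroupoid.IsEffective G ↔ IsMaximalCommutative (ArrowGroupoid.diagonal G R)) := by
  exact ⟨⟨ArrowGroupoid.diagonalHom G R, ArrowGroupoid.diagonalHom_injective,
      ArrowGroupoid.range_diagonalHom, fun _ hU f => ArrowGroupoid.diagonalHom_eq_deltaBar hU f⟩,
    ArrowGroupoid.isMaximalCommutative_diagonal_of_isEffective,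
    ArrowGroupoid.isEffective_of_isMaximalCommutative_diagonal⟩
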